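/- Let $n\ge 3$, let $X$ be a real normed space of dimension $n$ with closed unit ball $B_X$, and let $Y=\ker f$, where $f\in X^*$ and $\|f\|=1$. Let $\lambda(Y,X)=\inf\{\|P\| : P\colon X\to Y \text{ continuous linear},\ P|_Y=\mathrm{id}_Y\}$ be the relative projection constant of $Y$. Then $\lambda(Y,X)=2-\frac2n$ if and only if there exist extreme points $x_1,\dots,x_n$ of $B_X$ such that (1) $f(x_1)=f(x_2)=\dots=f(x_n)$; (2) $x_1,\dots,x_n$ are linearly independent; (3) for every vector $x=\sum_{i=1}^n w_i x_i\in X$ (with $w_i\in\mathbb R$), $$\max_{1\le i\le n}\,|w_1+\dots+w_{i-1}-w_i+w_{i+1}+\dots+w_n|\le \|x\|.$$ Moreover, for any linearly independent extreme points $x_1,\dots,x_n$ of $B_X$, condition (3) holds if and only if for every $1\le i\le n$ the set $\{x_1,\dots,x_{i-1},-x_i,x_{i+1},\dots,x_n\}$ is contained in a facet of $B_X$, that is, in an $(n-1)$-dimensional intersection of $B_X$ with one of its supporting hyperplanes. -/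

import Mathlib

/-- The set `𝒫(X, Y)` of all continuous linear projections from a real normed space `X` onto its
subspace `Y`, i.e. continuous linear maps `P : X → Y` which restrict to the identity on `Y`. -/
def projections {X : Type*} [NormedAddCommGroup X] [NormedSpace ℝ X] (Y : Submodule ℝ X) :
    Set (X →L[ℝ] Y) :=
  {P | ∀ y : Y, P (y : X) = y}

/-- In a finite-dimensional space there is a projection onto every subspace, so that the infimum in
`relProjConst` below is taken over a nonempty set (of nonnegative numbers). -/
theorem projections_nonempty {X : Type*} [NormedAddCommGroup X] [NormedSpace ℝ X]
    [FiniteDimensional ℝ X] (Y : Submodule ℝ X) : (projections Y).Nonempty := by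
  obtain ⟨P, hP⟩ := Submodule.ClosedComplemented.of_finiteDimensional Y
  exact ⟨P, hP⟩

/-- The relative projection constant `λ(Y, X)`: the infimum of the operator norms of the
projections from `X` onto `Y`. -/
noncomputable def relProjConst {X : Type*} [NormedAddCommGroup X] [NormedSpace ℝ X]
    (Y : Submodule ℝ X) : ℝ :=
  sInf ((fun P : X →L[ℝ] Y => ‖P‖) '' projections Y)

/-- `F` is a face of `C`: the intersection of `C` with a supporting hyperplane `{g = c}`
(a hyperplane that meets `C` and has `C` on one side). -/
def IsFaceOf {X : Type*} [NormedAddCommGroup X] [NormedSpace ℝ X] (C F : Set X) : Prop :=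
  ∃ (g : X →L[ℝ] ℝ) (c : ℝ), g ≠ 0 ∧ (∀ x ∈ C, g x ≤ c) ∧ (∃ x ∈ C, g x = c) ∧
    F = {x ∈ C | g x = c}

/-- `F` is a facet of `C`: a face whose affine dimension is `dim X - 1`. -/
def IsFacetOf {X : Type*} [NormedAddCommGroup X] [NormedSpace ℝ X] (C F : Set X) : Prop :=
  IsFaceOf C F ∧ Module.finrank ℝ (vectorSpan ℝ F) + 1 = Module.finrank ℝ X

/-- For every vector `v = w₁ x₁ + ⋯ + wₙ xₙ` and every `i`,
`|w₁ + ⋯ + wᵢ₋₁ - wᵢ + wᵢ₊₁ + ⋯ + wₙ| ≤ ‖v‖`. -/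
def CoordCondition {X : Type*} [NormedAddCommGroup X] [NormedSpace ℝ X] {n : ℕ}
    (x : Fin n → X) : Prop :=
  ∀ (v : X) (w : Fin n → ℝ), v = ∑ j, w j • x j →
    ∀ i, |(∑ j ∈ Finset.univ.erase i, w j) - w i| ≤ ‖v‖

/-- For every `i`, the set `{x₁, …, xᵢ₋₁, -xᵢ, xᵢ₊₁, …, xₙ}` is contained in a facet of the closed
unit ball. -/
def FacetCondition {X : Type*} [NormedAddCommGroup X] [NormedSpace ℝ X] {n : ℕ}
    (x : Fin n → X) : Prop :=
  ∀ i, ∃ F : Set X, IsFacetOf (Metric.closedBall (0 : X) 1) F ∧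
    Set.range (Function.update x i (-(x i))) ⊆ F

/-! Every projection onto `ker f` is `v ↦ v - f v • z` with `f z = 1`. For one of minimal norm `l`,
first-order optimality and Carathéodory in the dual of the (n-1)-dimensional kernel give n norming
pairs `(x k, g k)` and weights `a k` such that `∑ a k * f (x k) • g k` vanishes on `ker f`
(`exists_dual_certificate`). Testing this on `x j - f (x j) • z` eliminates `z` and leaves linear
relations between `l`, `s k = f (x k)` and the matrix `G k j = g k (x j)`, whose entries lie in [-1,
1].

If `l ≥ 2 - 2/n`, these relations force equality, `G` equal to 1 on the diagonal and -1 off it, and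
all `s k` equal (`extremal_pairing_rigidity`). The functionals `-g i` then witness `CoordCondition`,
and they make the `x k` independent and extreme. Conversely, such a system bounds every projection
norm below by `2 - 2/n` through averaging (`two_sub_two_div_le_norm`), and rigidity supplies the
upper bound. The facet criterion normalises the supporting functionals. -/

/-! ### Carathéodory and compact convex hulls -/

theorem exists_fin_of_mem_convexHull {E : Type*} [AddCommGroup E] [Module ℝ E]
    [FiniteDimensional ℝ E] {s : Set E} {x : E} (hx : x ∈ convexHull ℝ s) :
    ∃ w ∈ stdSimplex ℝ (Fin (Module.finrank ℝ E + 1)),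
      ∃ z : Fin (Module.finrank ℝ E + 1) → E, (∀ i, z i ∈ s) ∧ ∑ i, w i • z i = x := by
  obtain ⟨ι, _, z, w, hz, hai, hw, hw1, hsum⟩ := eq_pos_convex_span_of_mem_convexHull hx
  have hcard : Fintype.card ι ≤ Fintype.card (Fin (Module.finrank ℝ E + 1)) := by
    rw [Fintype.card_fin]
    exact hai.card_le_finrank_succ.trans (Nat.succ_le_succ (Submodule.finrank_le _))
  obtain ⟨e⟩ := Function.Embedding.nonempty_of_card_le hcard
  obtain ⟨z₀, hz₀⟩ := convexHull_nonempty_iff.1 ⟨x, hx⟩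
  have he : Function.Injective e := e.injective
  have hw0 : ∀ i ∉ Set.range e, Function.extend e w 0 i = 0 := fun i hi => by
    rw [Function.extend_apply' _ _ _ (by simpa using hi)]; rfl
  -- Carathéodory may use fewer points; spare slots get weight 0 and the dummy point `z₀` of `s`.
  refine ⟨Function.extend e w 0, ⟨fun i => ?_, ?_⟩, Function.extend e z fun _ => z₀,
    fun i => ?_, ?_⟩
  · by_cases hi : i ∈ Set.range e
    · obtain ⟨k, rfl⟩ := hi
      rw [he.extend_apply]
      exact (hw k).le
    · exact (hw0 i hi).ge
  · rw [← hw1]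
    exact (Fintype.sum_of_injective e he _ _ hw0 fun i => (he.extend_apply _ _ _).symm).symm
  · by_cases hi : i ∈ Set.range e
    · obtain ⟨k, rfl⟩ := hi
      rw [he.extend_apply]
      exact hz ⟨k, rfl⟩
    · rwa [Function.extend_apply' _ _ _ (by simpa using hi)]
  · rw [← hsum]
    refine (Fintype.sum_of_injective e he _ _ (fun i hi => ?_) fun i => ?_).symm
    · rw [hw0 i hi, zero_smul]
    · rw [he.extend_apply, he.extend_apply]

theorem isCompact_convexHull_of_finiteDimensional {E : Type*} [NormedAddCommGroup E]
    [NormedSpace ℝ E] [FiniteDimensional ℝ E] {s : Set E} (hs : IsCompact s) :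
    IsCompact (convexHull ℝ s) := by
  have hK : IsCompact (stdSimplex ℝ (Fin (Module.finrank ℝ E + 1)) ×ˢ
      (Set.univ.pi fun _ : Fin (Module.finrank ℝ E + 1) => s)) :=
    (isCompact_stdSimplex ℝ _).prod (isCompact_univ_pi fun _ => hs)
  have hc : Continuous fun p : (Fin (Module.finrank ℝ E + 1) → ℝ) ×
      (Fin (Module.finrank ℝ E + 1) → E) => ∑ i, p.1 i • p.2 i := by fun_prop
  convert hK.image hc using 1
  ext x
  constructor
  · intro hx
    obtain ⟨w, hw, z, hz, hsum⟩ := exists_fin_of_mem_convexHull hx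
    exact ⟨(w, z), ⟨hw, fun i _ => hz i⟩, hsum⟩
  · rintro ⟨⟨w, z⟩, ⟨hw, hz⟩, rfl⟩
    exact (convex_convexHull ℝ s).sum_mem (fun i _ => hw.1 i) hw.2
      fun i _ => subset_convexHull ℝ s (hz i trivial)

/-! ### Minimal projections and their dual certificates -/

theorem ContinuousLinearMap.exists_norm_eq_apply {X V : Type*} [NormedAddCommGroup X]
    [NormedSpace ℝ X] [FiniteDimensional ℝ X] [NormedAddCommGroup V] [NormedSpace ℝ V]
    (T : X →L[ℝ] V) : ∃ x : X, ‖x‖ ≤ 1 ∧ ‖T x‖ = ‖T‖ := by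
  have := FiniteDimensional.proper ℝ X
  obtain ⟨x, hx, hmax⟩ := (isCompact_closedBall (0 : X) 1).exists_isMaxOn
    ⟨0, by simp⟩ (f := fun x => ‖T x‖) (by fun_prop)
  have hx1 : ‖x‖ ≤ 1 := by simpa using hx
  refine ⟨x, hx1, le_antisymm (T.unit_le_opNorm x hx1) ?_⟩
  exact T.opNorm_le_of_unit_norm (norm_nonneg _) fun y hy => hmax (by simp [hy])

theorem relProjConst_le_norm {X : Type*} [NormedAddCommGroup X] [NormedSpace ℝ X]
    {Y : Submodule ℝ X} {P : X →L[ℝ] Y} (hP : P ∈ projections Y) :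
    relProjConst Y ≤ ‖P‖ :=
  csInf_le ⟨0, by rintro _ ⟨Q, -, rfl⟩; exact norm_nonneg Q⟩ ⟨P, hP, rfl⟩

section

variable {X : Type*} [NormedAddCommGroup X] [NormedSpace ℝ X] [FiniteDimensional ℝ X]

theorem exists_norm_eq_relProjConst (Y : Submodule ℝ X) :
    ∃ P ∈ projections Y, ‖P‖ = relProjConst Y := by
  have := FiniteDimensional.proper ℝ (X →L[ℝ] Y)
  have hcl : IsClosed (projections Y) := by
    have : projections Y = ⋂ y : Y, {P : X →L[ℝ] Y | P (y : X) = y} := by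
      ext P; simp [projections]
    rw [this]
    exact isClosed_iInter fun y => isClosed_eq (by fun_prop) continuous_const
  obtain ⟨P, hP, hd⟩ := hcl.exists_infDist_eq_dist (projections_nonempty Y) 0
  refine ⟨P, hP, le_antisymm ?_ (relProjConst_le_norm hP)⟩
  refine le_csInf ((projections_nonempty Y).image _) ?_
  rintro _ ⟨Q, hQ, rfl⟩
  have := Metric.infDist_le_dist_of_mem (x := (0 : X →L[ℝ] Y)) hQ
  rw [hd] at this
  exact (dist_zero_left P).ge.trans (this.trans (dist_zero_left Q).le)

/-- First-order optimality of a projection of minimal norm onto the kernel of `f`. -/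
theorem exists_normingPair_mul_nonpos {f : X →L[ℝ] ℝ}
    {P : X →L[ℝ] LinearMap.ker (f : X →ₗ[ℝ] ℝ)}
    (hP : P ∈ projections (LinearMap.ker (f : X →ₗ[ℝ] ℝ)))
    (hmin : ∀ Q ∈ projections (LinearMap.ker (f : X →ₗ[ℝ] ℝ)), ‖P‖ ≤ ‖Q‖)
    (y : LinearMap.ker (f : X →ₗ[ℝ] ℝ)) :
    ∃ (x : X) (g : X →L[ℝ] ℝ), ‖x‖ ≤ 1 ∧ ‖g‖ ≤ 1 ∧ g (P x) = ‖P‖ ∧ f x * g y ≤ 0 := by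
  by_contra! H
  have := FiniteDimensional.proper ℝ X
  have := FiniteDimensional.proper ℝ (X →L[ℝ] ℝ)
  have happ : ∀ (g : X →L[ℝ] ℝ) (z : X), ‖g‖ ≤ 1 → |g z| ≤ ‖z‖ := fun g z hg => by
    simpa using g.le_of_opNorm_le hg z
  have hle : ∀ (x : X) (g : X →L[ℝ] ℝ), ‖x‖ ≤ 1 → ‖g‖ ≤ 1 → g (P x) ≤ ‖P‖ :=
    fun x g hx hg => (le_abs_self _).trans ((happ g _ hg).trans (P.unit_le_opNorm x hx))
  have hK : IsCompact ((Metric.closedBall (0 : X) 1 ×ˢ Metric.closedBall (0 : X →L[ℝ] ℝ) 1) ∩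
      {p | f p.1 * p.2 y ≤ 0}) :=
    ((isCompact_closedBall _ _).prod (isCompact_closedBall _ _)).inter_right
      (isClosed_le (by fun_prop) continuous_const)
  obtain ⟨⟨x₀, g₀⟩, ⟨⟨hx₀, hg₀⟩, h₀⟩, hmax⟩ := hK.exists_isMaxOn ⟨(0, 0), by simp⟩
    (f := fun p => p.2 (P p.1)) (by fun_prop)
  simp only [mem_closedBall_zero_iff] at hx₀ hg₀
  have hlt : g₀ (P x₀) < ‖P‖ := (hle x₀ g₀ hx₀ hg₀).lt_of_ne fun h =>
    (H x₀ g₀ hx₀ hg₀ h).not_ge h₀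
  -- Perturb `P` by `-ε f ⊗ y`. Pairs with `f x * g y ≤ 0` stay below `‖P‖` by this choice of `ε`;
  -- the others strictly decrease.
  obtain ⟨ε, hε, hεy⟩ : ∃ ε > 0, ε * (‖f‖ * ‖y‖) < ‖P‖ - g₀ (P x₀) := by
    have h0 : 0 < ‖P‖ - g₀ (P x₀) := by linarith
    have h1 : 0 ≤ ‖f‖ * ‖y‖ := by positivity
    refine ⟨(‖P‖ - g₀ (P x₀)) / (‖f‖ * ‖y‖ + 1), by positivity, ?_⟩
    rw [div_mul_eq_mul_div, div_lt_iff₀ (by positivity)]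
    nlinarith
  have hQ := hmin (P - ε • f.smulRight y) fun z => by
    have hz : f z = 0 := z.2
    simp [hP z, hz]
  obtain ⟨x, hx, hQx⟩ := (P - ε • f.smulRight y).exists_norm_eq_apply
  obtain ⟨g, hg, hgx⟩ := exists_dual_vector'' ℝ (((P - ε • f.smulRight y) x : _) : X)
  have key : ‖P‖ ≤ g (P x) - ε * (f x * g y) := by
    have : g (((P - ε • f.smulRight y) x : _) : X) = g (P x) - ε * (f x * g y) := by simp
    rw [← this, hgx]
    exact hQ.trans hQx.ge
  rcases le_or_gt (f x * g y) 0 with hs | hs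
  · have h1 : g (P x) ≤ g₀ (P x₀) :=
      hmax (a := (x, g)) ⟨⟨by simpa using hx, by simpa using hg⟩, hs⟩
    have h2 : |f x * g y| ≤ ‖f‖ * ‖y‖ := by
      rw [abs_mul]
      exact mul_le_mul (f.unit_le_opNorm x hx) (happ g y hg) (abs_nonneg _) (norm_nonneg _)
    nlinarith [neg_abs_le (f x * g y)]
  · nlinarith [hle x g hx hg, mul_pos hε hs]

/-- The dual certificate of a projection of minimal norm onto the kernel of `f`. -/
theorem exists_dual_certificate {f : X →L[ℝ] ℝ} (hf : f ≠ 0)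
    {P : X →L[ℝ] LinearMap.ker (f : X →ₗ[ℝ] ℝ)}
    (hP : P ∈ projections (LinearMap.ker (f : X →ₗ[ℝ] ℝ)))
    (hmin : ∀ Q ∈ projections (LinearMap.ker (f : X →ₗ[ℝ] ℝ)), ‖P‖ ≤ ‖Q‖) :
    ∃ w ∈ stdSimplex ℝ (Fin (Module.finrank ℝ X)),
      ∃ (x : Fin (Module.finrank ℝ X) → X) (g : Fin (Module.finrank ℝ X) → X →L[ℝ] ℝ),
        (∀ k, ‖x k‖ ≤ 1) ∧ (∀ k, ‖g k‖ ≤ 1) ∧ (∀ k, g k (P (x k)) = ‖P‖) ∧ (∀ k, 0 ≤ f (x k)) ∧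
        ∀ y, f y = 0 → ∑ k, w k * (f (x k) * g k y) = 0 := by
  have := FiniteDimensional.proper ℝ X
  have := FiniteDimensional.proper ℝ (X →L[ℝ] ℝ)
  let Y := LinearMap.ker (f : X →ₗ[ℝ] ℝ)
  have hdim : Module.finrank ℝ (Fin (Module.finrank ℝ Y) → ℝ) + 1 = Module.finrank ℝ X := by
    rw [Module.finrank_fin_fun]
    refine Module.Dual.finrank_ker_add_one_of_ne_zero (f := (f : X →ₗ[ℝ] ℝ)) fun h => hf ?_
    ext v
    simpa using LinearMap.congr_fun h v
  let b := Module.finBasis ℝ Y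
  let Ψ : X × (X →L[ℝ] ℝ) → Fin (Module.finrank ℝ Y) → ℝ := fun p i => f p.1 * p.2 (b i)
  let K : Set (X × (X →L[ℝ] ℝ)) :=
    (Metric.closedBall (0 : X) 1 ×ˢ Metric.closedBall (0 : X →L[ℝ] ℝ) 1) ∩
      {p | p.2 (P p.1) = ‖P‖}
  have hK : IsCompact K :=
    ((isCompact_closedBall _ _).prod (isCompact_closedBall _ _)).inter_right
      (isClosed_eq (by fun_prop) continuous_const)
  have hΨ : Continuous Ψ := by fun_prop
  have hmem : (0 : Fin (Module.finrank ℝ Y) → ℝ) ∈ convexHull ℝ (Ψ '' K) := by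
    by_contra h0
    obtain ⟨φ, u, hu0, hu⟩ := geometric_hahn_banach_point_closed (convex_convexHull ℝ _)
      (isCompact_convexHull_of_finiteDimensional (hK.image hΨ)).isClosed h0
    -- The separating `φ` is evaluation at this vector of `Y`, so it would be positive on every
    -- norming pair.
    obtain ⟨x, g, hx, hg, hxg, hle⟩ := exists_normingPair_mul_nonpos hP hmin
      (∑ i, φ (Pi.single i 1) • b i)
    have h1 := hu (Ψ (x, g)) (subset_convexHull ℝ _
      ⟨(x, g), ⟨⟨by simpa using hx, by simpa using hg⟩, hxg⟩, rfl⟩)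
    have h2 : φ (Ψ (x, g)) = f x * g (∑ i, φ (Pi.single i 1) • b i : Y) := by
      conv_lhs => rw [pi_eq_sum_univ' (Ψ (x, g))]
      simp only [map_sum, map_smul, smul_eq_mul, Submodule.coe_sum, Submodule.coe_smul,
        Finset.mul_sum, Ψ]
      refine Finset.sum_congr rfl fun i _ => ?_
      ring
    rw [map_zero] at hu0
    linarith
  rw [← hdim]
  obtain ⟨w, hw, z, hz, hsum⟩ := exists_fin_of_mem_convexHull hmem
  -- Replacing `(x, g)` by `(-x, -g)` changes neither `g (P x)` nor `Ψ`.
  have hflip : ∀ k, ∃ p : X × (X →L[ℝ] ℝ), ‖p.1‖ ≤ 1 ∧ ‖p.2‖ ≤ 1 ∧ p.2 (P p.1) = ‖P‖ ∧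
      0 ≤ f p.1 ∧ Ψ p = z k := fun k => by
    obtain ⟨⟨x, g⟩, ⟨⟨hx, hg⟩, hp⟩, hpz⟩ := hz k
    simp only [mem_closedBall_zero_iff] at hx hg
    rcases le_total 0 (f x) with h | h
    · exact ⟨(x, g), hx, hg, hp, h, hpz⟩
    · refine ⟨(-x, -g), by simpa using hx, by simpa using hg, ?_, by simpa using h, ?_⟩
      · simpa using hp
      · rw [← hpz]; ext i; simp [Ψ]
  choose p hp1 hp2 hp3 hp4 hp5 using hflip
  refine ⟨w, hw, fun k => (p k).1, fun k => (p k).2, hp1, hp2, hp3, hp4, fun y hy => ?_⟩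
  let L : Y →ₗ[ℝ] ℝ := ∑ k, (w k * f (p k).1) • (((p k).2 : X →ₗ[ℝ] ℝ) ∘ₗ Y.subtype)
  have hL : L = 0 := b.ext fun i => by
    have := congrFun hsum i
    simp only [← hp5, Finset.sum_apply, Pi.smul_apply, smul_eq_mul, Pi.zero_apply, Ψ] at this
    simpa [L, LinearMap.sum_apply, mul_assoc] using this
  have := LinearMap.congr_fun hL ⟨y, hy⟩
  simpa [L, LinearMap.sum_apply, mul_assoc] using this

end

/-! ### Rigidity of the pairing matrix -/

/-- Combines the relations `hG` with weights `c`. For `c ≥ 0`, `a ≥ 0`, `s ≥ 0` and `|G| ≤ 1`, the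
left side is a sum of nonnegative defects of `G` from 1 on and -1 off the diagonal. -/
theorem extremal_pairing_identity {ι : Type*} [Fintype ι] {a s : ι → ℝ} {G : ι → ι → ℝ} {l : ℝ}
    (ha1 : ∑ k, a k = 1)
    (hG : ∀ j, s j * l = s j * ∑ k, a k * G k k - ∑ k, a k * s k * G k j) (c : ι → ℝ) :
    ∑ k, a k * ((∑ j, c j * s j) - c k * s k) * (1 - G k k) +
        ∑ k, a k * s k * ((∑ j, c j * (1 + G k j)) - c k * (1 + G k k)) =
      (∑ j, c j * s j) + (∑ k, a k * s k) * (∑ j, c j) - 2 * ∑ k, a k * c k * s k -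
        (∑ j, c j * s j) * l := by
  have h1 : (∑ j, c j * s j) * l = (∑ j, c j * s j) * (∑ k, a k * G k k) -
      ∑ k, a k * s k * ∑ j, c j * G k j := by
    have : ∑ k, a k * s k * ∑ j, c j * G k j = ∑ j, c j * ∑ k, a k * s k * G k j := by
      simp only [Finset.mul_sum]
      rw [Finset.sum_comm]
      exact Finset.sum_congr rfl fun j _ => Finset.sum_congr rfl fun k _ => by ring
    rw [this, Finset.sum_mul, Finset.sum_mul, ← Finset.sum_sub_distrib]
    refine Finset.sum_congr rfl fun j _ => ?_
    rw [mul_assoc, hG j]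
    ring
  have h2 : ∀ C : ℝ, ∑ k, a k * (C - c k * s k) * (1 - G k k) = C * ∑ k, a k -
      ∑ k, a k * c k * s k - C * ∑ k, a k * G k k + ∑ k, a k * c k * s k * G k k := fun C => by
    simp only [Finset.mul_sum, ← Finset.sum_sub_distrib, ← Finset.sum_add_distrib]
    exact Finset.sum_congr rfl fun k _ => by ring
  have h3 : ∑ k, a k * s k * ((∑ j, c j * (1 + G k j)) - c k * (1 + G k k)) =
      (∑ k, a k * s k) * (∑ j, c j) + ∑ k, a k * s k * ∑ j, c j * G k j -
        ∑ k, a k * c k * s k - ∑ k, a k * c k * s k * G k k := by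
    simp only [mul_add, mul_one, Finset.sum_add_distrib]
    rw [Finset.sum_mul, ← Finset.sum_add_distrib, ← Finset.sum_sub_distrib,
      ← Finset.sum_sub_distrib]
    exact Finset.sum_congr rfl fun k _ => by ring
  rw [h2, h3, h1, ha1]
  ring

/-- The identity with `c = 1` gives `S ≤ n t`, and with `c = a` gives `n r ≤ t`. Together they make
`∑ s k * (n * a k - 1)²` nonpositive, so `a k = 1/n` and all defects vanish. -/
theorem extremal_pairing_rigidity {n : ℕ} (hn : 3 ≤ n) {a s : Fin n → ℝ} {G : Fin n → Fin n → ℝ}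
    {l : ℝ} (ha : ∀ k, 0 ≤ a k) (ha1 : ∑ k, a k = 1) (hs : ∀ k, 0 < s k)
    (hG1 : ∀ k j, |G k j| ≤ 1) (hl : 2 - 2 / (n : ℝ) ≤ l)
    (hG : ∀ j, s j * l = s j * ∑ k, a k * G k k - ∑ k, a k * s k * G k j) :
    l = 2 - 2 / (n : ℝ) ∧ (∀ k, G k k = 1) ∧ (∀ k j, j ≠ k → G k j = -1) ∧
      ∀ i j, s i = s j := by
  have hn' : (3 : ℝ) ≤ n := by exact_mod_cast hn
  have hn0 : (0 : ℝ) < n := by linarith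
  have hterm1 : ∀ c : Fin n → ℝ, (∀ j, 0 ≤ c j) → ∀ k,
      0 ≤ a k * ((∑ j, c j * s j) - c k * s k) * (1 - G k k) := fun c hc k => by
    have := Finset.single_le_sum (f := fun j => c j * s j)
      (fun j _ => mul_nonneg (hc j) (hs j).le) (Finset.mem_univ k)
    exact mul_nonneg (mul_nonneg (ha k) (by simpa using this))
      (by linarith [(abs_le.1 (hG1 k k)).2])
  have hterm2 : ∀ c : Fin n → ℝ, (∀ j, 0 ≤ c j) → ∀ k,
      0 ≤ a k * s k * ((∑ j, c j * (1 + G k j)) - c k * (1 + G k k)) := fun c hc k => by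
    have := Finset.single_le_sum (f := fun j => c j * (1 + G k j))
      (fun j _ => mul_nonneg (hc j) (by linarith [(abs_le.1 (hG1 k j)).1])) (Finset.mem_univ k)
    exact mul_nonneg (mul_nonneg (ha k) (hs k).le) (by simpa using this)
  have hone := extremal_pairing_identity ha1 hG fun _ => 1
  have hone1 := hterm1 (fun _ => 1) fun _ => zero_le_one
  have hone2 := hterm2 (fun _ => 1) fun _ => zero_le_one
  have hA := extremal_pairing_identity ha1 hG a
  have hA1 := Finset.sum_nonneg fun k (_ : k ∈ Finset.univ) => hterm1 a ha k
  have hA2 := Finset.sum_nonneg fun k (_ : k ∈ Finset.univ) => hterm2 a ha k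
  have hO1 := Finset.sum_nonneg fun k (_ : k ∈ Finset.univ) => hone1 k
  have hO2 := Finset.sum_nonneg fun k (_ : k ∈ Finset.univ) => hone2 k
  have hS : 0 < ∑ j, s j :=
    Finset.sum_pos (fun j _ => hs j) ⟨⟨0, by omega⟩, Finset.mem_univ _⟩
  have ht0 : 0 ≤ ∑ k, a k * s k := Finset.sum_nonneg fun k _ => mul_nonneg (ha k) (hs k).le
  simp only [one_mul, mul_one, Finset.sum_const, Finset.card_univ, Fintype.card_fin,
    nsmul_eq_mul] at hone hone1 hone2 hO1 hO2
  rw [ha1] at hA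
  set S := ∑ j, s j with hSdef
  set t := ∑ k, a k * s k with htdef
  set r := ∑ k, a k * a k * s k with hrdef
  have hl' : 2 * n - 2 ≤ n * l := by
    have := mul_le_mul_of_nonneg_left hl hn0.le
    have h2 : (n : ℝ) * (2 - 2 / n) = 2 * n - 2 := by field_simp
    linarith
  have hSt : S ≤ n * t := by
    have h1 : n * S + n * (n * t) - 2 * (n * t) - S * (n * l) ≥ 0 := by nlinarith
    have h2 : S * (2 * n - 2) ≤ S * (n * l) := mul_le_mul_of_nonneg_left hl' hS.le
    have h3 : 0 ≤ (n - 2) * (n * t - S) := by nlinarith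
    nlinarith [nonneg_of_mul_nonneg_right h3 (by linarith)]
  have hrt : n * r ≤ t := by
    have h1 : n * t + n * t - 2 * (n * r) - t * (n * l) ≥ 0 := by nlinarith
    have h2 : t * (2 * n - 2) ≤ t * (n * l) := mul_le_mul_of_nonneg_left hl' ht0
    nlinarith
  have hsq : ∑ k, s k * (n * a k - 1) ^ 2 = n * (n * r) - 2 * (n * t) + S := by
    simp only [hrdef, htdef, hSdef, Finset.mul_sum, ← Finset.sum_sub_distrib,
      ← Finset.sum_add_distrib]
    exact Finset.sum_congr rfl fun k _ => by ring
  have hsq0 : ∀ k ∈ Finset.univ, 0 ≤ s k * (n * a k - 1) ^ 2 :=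
    fun k _ => mul_nonneg (hs k).le (sq_nonneg _)
  have hzero : ∑ k, s k * (n * a k - 1) ^ 2 = 0 := by
    refine le_antisymm ?_ (Finset.sum_nonneg hsq0)
    rw [hsq]
    nlinarith
  have ha' : ∀ k, a k = 1 / n := fun k => by
    have h1 := (Finset.sum_eq_zero_iff_of_nonneg hsq0).1 hzero k (Finset.mem_univ k)
    have h2 : n * a k - 1 = 0 := by
      rcases mul_eq_zero.1 h1 with h | h
      · exact absurd h (hs k).ne'
      · exact pow_eq_zero_iff (two_ne_zero) |>.1 h
    rw [eq_div_iff hn0.ne']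
    linarith
  have ht : n * t = S := by
    rw [htdef, Finset.mul_sum, hSdef]
    exact Finset.sum_congr rfl fun k _ => by rw [ha' k]; field_simp
  have hD : ∑ k, a k * (S - s k) * (1 - G k k) +
      ∑ k, a k * s k * ((∑ j, (1 + G k j)) - (1 + G k k)) = 0 ∧ n * l = 2 * n - 2 := by
    have h1 : S * (n * l - (2 * n - 2)) +
        n * (∑ k, a k * (S - s k) * (1 - G k k) +
          ∑ k, a k * s k * ((∑ j, (1 + G k j)) - (1 + G k k))) = 0 := by
      rw [hone]
      linear_combination (n - 2 : ℝ) * ht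
    have h2 : 0 ≤ S * (n * l - (2 * n - 2)) := mul_nonneg hS.le (by linarith)
    have h3 := mul_nonneg hn0.le (add_nonneg hO1 hO2)
    constructor
    · have : (n : ℝ) * _ = 0 := le_antisymm (by linarith) h3
      exact (mul_eq_zero.1 this).resolve_left hn0.ne'
    · have : S * (n * l - (2 * n - 2)) = 0 := le_antisymm (by linarith) h2
      linarith [(mul_eq_zero.1 this).resolve_left hS.ne']
  obtain ⟨hD, hnl⟩ := hD
  have hapos : ∀ k, 0 < a k := fun k => by rw [ha' k]; positivity
  have hdiag : ∀ k, G k k = 1 := fun k => by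
    have h1 := (Finset.sum_eq_zero_iff_of_nonneg fun k _ => hone1 k).1
      (le_antisymm (by linarith) hO1) k (Finset.mem_univ k)
    obtain ⟨j, hj⟩ : ∃ j, j ≠ k :=
      have : Nontrivial (Fin n) := Fin.nontrivial_iff_two_le.2 (by omega)
      exists_ne k
    have h2 : s k < S := Finset.single_lt_sum hj (Finset.mem_univ k) (Finset.mem_univ j) (hs j)
      fun i _ _ => (hs i).le
    have h3 := (mul_eq_zero.1 h1).resolve_left (mul_pos (hapos k) (by linarith)).ne'
    linarith
  have hoff : ∀ k j, j ≠ k → G k j = -1 := fun k j hj => by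
    have h1 := (Finset.sum_eq_zero_iff_of_nonneg fun k _ => hone2 k).1
      (le_antisymm (by linarith) hO2) k (Finset.mem_univ k)
    have h2 := (mul_eq_zero.1 h1).resolve_left (mul_pos (hapos k) (hs k)).ne'
    rw [← Finset.sum_erase_eq_sub (Finset.mem_univ k)] at h2
    have h3 := (Finset.sum_eq_zero_iff_of_nonneg fun i _ => by
      linarith [(abs_le.1 (hG1 k i)).1]).1 h2 j (Finset.mem_erase.2 ⟨hj, Finset.mem_univ j⟩)
    linarith
  have hsj : ∀ j, n * s j = S := fun j => by
    have h1 : ∑ k, a k * G k k = 1 := by simp only [hdiag, mul_one, ha1]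
    have h2 : ∑ k, a k * s k * G k j = a j * s j + a j * s j - t := by
      have : ∀ k, a k * s k * G k j = (if k = j then a j * s j + a j * s j else 0) - a k * s k := by
        intro k
        split_ifs with h
        · subst h; rw [hdiag]; ring
        · rw [hoff k j (Ne.symm h)]; ring
      rw [Finset.sum_congr rfl fun k _ => this k, Finset.sum_sub_distrib,
        Finset.sum_ite_eq' Finset.univ j]
      simp [htdef]
    have h3 := hG j
    rw [h1, h2] at h3
    have h4 : n * a j = 1 := by rw [ha' j]; field_simp
    linear_combination n * h3 - s j * hnl - 2 * s j * h4 + ht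
  refine ⟨?_, hdiag, hoff, fun i j => ?_⟩
  · field_simp
    linarith
  · exact mul_left_cancel₀ hn0.ne' ((hsj i).trans (hsj j).symm)

/-! ### Sign functionals, extreme points and facets -/

theorem eq_zero_of_sum_erase_sub_eq_zero {n : ℕ} (hn : 3 ≤ n) {w : Fin n → ℝ}
    (hw : ∀ i, (∑ j ∈ Finset.univ.erase i, w j) - w i = 0) : w = 0 := by
  have hn' : (3 : ℝ) ≤ n := by exact_mod_cast hn
  have h : ∀ i, 2 * w i = ∑ j, w j := fun i => by
    have := hw i
    rw [Finset.sum_erase_eq_sub (Finset.mem_univ i)] at this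
    linarith
  have h0 : ∑ j, w j = 0 := by
    have h1 : ∑ i : Fin n, 2 * w i = ∑ i : Fin n, ∑ j, w j := Finset.sum_congr rfl fun i _ => h i
    rw [← Finset.mul_sum] at h1
    simp only [Finset.sum_const, Finset.card_univ, Fintype.card_fin, nsmul_eq_mul] at h1
    have h2 : ((n : ℝ) - 2) * ∑ j, w j = 0 := by linarith
    exact (mul_eq_zero.1 h2).resolve_left (by linarith)
  ext i
  have := h i
  simp only [Pi.zero_apply]
  linarith

section

variable {X : Type*} [NormedAddCommGroup X] [NormedSpace ℝ X]

theorem apply_sum_smul_of_reflection {n : ℕ} {x : Fin n → X} {g : X →L[ℝ] ℝ} {i : Fin n} {c : ℝ}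
    (hi : g (x i) = -c) (hj : ∀ j, j ≠ i → g (x j) = c) (w : Fin n → ℝ) :
    g (∑ j, w j • x j) = c * ((∑ j ∈ Finset.univ.erase i, w j) - w i) := by
  rw [map_sum, ← Finset.sum_erase_add _ _ (Finset.mem_univ i),
    Finset.sum_congr rfl fun j hj' => by rw [map_smul, hj j (Finset.ne_of_mem_erase hj')],
    map_smul, hi]
  simp only [smul_eq_mul, ← Finset.sum_mul]
  ring

theorem coordCondition_iff_exists_functional [FiniteDimensional ℝ X] {n : ℕ} {x : Fin n → X}
    (hX : Module.finrank ℝ X = n) (hx : LinearIndependent ℝ x) :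
    CoordCondition x ↔ ∀ i, ∃ g : X →L[ℝ] ℝ, ‖g‖ ≤ 1 ∧ g (x i) = -1 ∧ ∀ j, j ≠ i → g (x j) = 1 := by
  classical
  have hspan : ⊤ ≤ Submodule.span ℝ (Set.range x) :=
    (hx.span_eq_top_of_card_eq_finrank' (by simp [hX])).ge
  let b := Module.Basis.mk hx hspan
  constructor
  · intro h i
    let g : X →L[ℝ] ℝ := LinearMap.toContinuousLinearMap
      (b.constr ℝ fun j => if j = i then (-1 : ℝ) else 1)
    have hg : ∀ j, g (x j) = if j = i then -1 else 1 := fun j => by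
      have : x j = b j := (Module.Basis.mk_apply hx hspan j).symm
      rw [this]
      exact b.constr_basis ℝ _ j
    have hgi : g (x i) = -1 := by simp [hg]
    have hgj : ∀ j, j ≠ i → g (x j) = 1 := fun j hj => by simp [hg, hj]
    refine ⟨g, g.opNorm_le_bound zero_le_one fun v => ?_, hgi, hgj⟩
    have hv : v = ∑ j, b.repr v j • x j := by
      conv_lhs => rw [← b.sum_repr v]
      exact Finset.sum_congr rfl fun j _ => by rw [Module.Basis.mk_apply]
    have := apply_sum_smul_of_reflection hgi hgj (b.repr v)
    rw [← hv, one_mul] at this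
    rw [this, one_mul]
    exact h v _ hv i
  · rintro h v w rfl i
    obtain ⟨g, hg, hgi, hgj⟩ := h i
    rw [← one_mul ((∑ j ∈ Finset.univ.erase i, w j) - w i),
      ← apply_sum_smul_of_reflection hgi hgj w]
    simpa using g.le_of_opNorm_le hg (∑ j, w j • x j)

theorem linearIndependent_of_reflection {n : ℕ} (hn : 3 ≤ n) {x : Fin n → X}
    {g : Fin n → X →L[ℝ] ℝ} (hi : ∀ i, g i (x i) = -1) (hj : ∀ i j, j ≠ i → g i (x j) = 1) :
    LinearIndependent ℝ x := by
  refine Fintype.linearIndependent_iff.2 fun w hw => congrFun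
    (eq_zero_of_sum_erase_sub_eq_zero hn fun i => ?_)
  have := apply_sum_smul_of_reflection (hi i) (hj i) w
  rw [hw, map_zero, one_mul] at this
  exact this.symm

theorem eq_zero_of_reflection_apply_eq_zero [FiniteDimensional ℝ X] {n : ℕ} (hn : 3 ≤ n)
    (hX : Module.finrank ℝ X = n) {x : Fin n → X} {g : Fin n → X →L[ℝ] ℝ}
    (hi : ∀ i, g i (x i) = -1) (hj : ∀ i j, j ≠ i → g i (x j) = 1) {v : X}
    (hv : ∀ i, g i v = 0) : v = 0 := by
  have hspan : ⊤ ≤ Submodule.span ℝ (Set.range x) :=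
    ((linearIndependent_of_reflection hn hi hj).span_eq_top_of_card_eq_finrank'
      (by simp [hX])).ge
  obtain ⟨w, rfl⟩ := (Submodule.mem_span_range_iff_exists_fun ℝ).1
    (hspan (Submodule.mem_top (x := v)))
  have : w = 0 := eq_zero_of_sum_erase_sub_eq_zero hn fun i => by
    have := apply_sum_smul_of_reflection (hi i) (hj i) w
    rw [hv, one_mul] at this
    exact this.symm
  simp [this]

theorem eq_of_mem_openSegment_of_apply_eq {g : X →L[ℝ] ℝ} (hg : ‖g‖ ≤ 1) {u v z : X} {e : ℝ}
    (he : |e| = 1) (hu : ‖u‖ ≤ 1) (hv : ‖v‖ ≤ 1) (hz : z ∈ openSegment ℝ u v) (hgz : g z = e) :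
    g u = e := by
  have hgu : |g u| ≤ 1 := (g.le_of_opNorm_le hg u).trans (by simpa using hu)
  have hgv : |g v| ≤ 1 := (g.le_of_opNorm_le hg v).trans (by simpa using hv)
  obtain ⟨a, b, ha, hb, hab, rfl⟩ := hz
  simp only [map_add, map_smul, smul_eq_mul] at hgz
  rw [abs_le] at hgu hgv
  rcases eq_or_eq_neg_of_abs_eq he with rfl | rfl
  · nlinarith
  · nlinarith

/-- Each `g i` attains ±1 at `x k`, hence is constant on any segment of the ball with `x k` inside;
the `g i` jointly separate points. -/
theorem mem_extremePoints_closedBall_of_reflection [FiniteDimensional ℝ X] {n : ℕ} (hn : 3 ≤ n)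
    (hX : Module.finrank ℝ X = n) {x : Fin n → X} {g : Fin n → X →L[ℝ] ℝ} (hg : ∀ i, ‖g i‖ ≤ 1)
    (hi : ∀ i, g i (x i) = -1) (hj : ∀ i j, j ≠ i → g i (x j) = 1) (hx : ∀ i, ‖x i‖ ≤ 1)
    (k : Fin n) : x k ∈ (Metric.closedBall (0 : X) 1).extremePoints ℝ := by
  refine mem_extremePoints_iff_left.2 ⟨by simpa using hx k, fun u hu v hv hz => ?_⟩
  rw [mem_closedBall_zero_iff] at hu hv
  refine sub_eq_zero.1 (eq_zero_of_reflection_apply_eq_zero hn hX hi hj fun i => ?_)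
  rw [map_sub, sub_eq_zero]
  refine eq_of_mem_openSegment_of_apply_eq (hg i) ?_ hu hv hz rfl
  by_cases h : k = i
  · subst h; simp [hi]
  · simp [hj i k h]

theorem norm_le_of_forall_closedBall_le {g : X →L[ℝ] ℝ} {c : ℝ}
    (h : ∀ v ∈ Metric.closedBall (0 : X) 1, g v ≤ c) : ‖g‖ ≤ c := by
  have hc : 0 ≤ c := by simpa using h 0 (by simp)
  refine g.opNorm_le_of_unit_norm hc fun v hv => abs_le.2 ⟨?_, h v (by simp [hv])⟩
  have := h (-v) (by simp [hv])
  rw [map_neg] at this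
  linarith

/-- The direction of `F` lies between that of n affinely independent points and `ker g`, both of
dimension n-1. -/
theorem finrank_vectorSpan_add_one_of_level [FiniteDimensional ℝ X] {n : ℕ} (hn : 1 ≤ n)
    (hX : Module.finrank ℝ X = n) {y : Fin n → X} (hy : LinearIndependent ℝ y) {F : Set X}
    (hyF : Set.range y ⊆ F) {g : X →L[ℝ] ℝ} {c : ℝ} (hg : g ≠ 0) (hgF : ∀ v ∈ F, g v = c) :
    Module.finrank ℝ (vectorSpan ℝ F) + 1 = Module.finrank ℝ X := by
  have hker := Module.Dual.finrank_ker_add_one_of_ne_zero (f := (g : X →ₗ[ℝ] ℝ)) fun h => hg (by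
    ext v
    simpa using LinearMap.congr_fun h v)
  have h1 : vectorSpan ℝ F ≤ LinearMap.ker (g : X →ₗ[ℝ] ℝ) := by
    rw [vectorSpan_def, Submodule.span_le]
    rintro _ ⟨u, hu, v, hv, rfl⟩
    simp [hgF u hu, hgF v hv]
  have h2 := Submodule.finrank_mono h1
  have h3 := Submodule.finrank_mono (vectorSpan_mono ℝ hyF)
  have h4 : Module.finrank ℝ (vectorSpan ℝ (Set.range y)) = n - 1 :=
    hy.affineIndependent.finrank_vectorSpan (by simp; omega)
  omega

theorem coordCondition_iff_facetCondition [FiniteDimensional ℝ X] {n : ℕ} (hn : 1 ≤ n)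
    (hX : Module.finrank ℝ X = n) {x : Fin n → X} (hx1 : ∀ i, ‖x i‖ ≤ 1)
    (hx : LinearIndependent ℝ x) : CoordCondition x ↔ FacetCondition x := by
  rw [coordCondition_iff_exists_functional hX hx]
  constructor
  · intro h i
    obtain ⟨g, hg, hgi, hgj⟩ := h i
    have hgy : ∀ j, g (Function.update x i (-(x i)) j) = 1 := fun j => by
      by_cases hj : j = i
      · subst hj; simp [hgi]
      · simp [hj, hgj j hj]
    have hy1 : ∀ j, ‖Function.update x i (-(x i)) j‖ ≤ 1 := fun j => by
      by_cases hj : j = i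
      · subst hj; simpa using hx1 j
      · simpa [hj] using hx1 j
    have hy : LinearIndependent ℝ (Function.update x i (-(x i))) := by
      have := hx.units_smul (Function.update (1 : Fin n → ℝˣ) i (-1))
      convert this using 1
      ext j
      by_cases hj : j = i
      · subst hj; simp
      · simp [hj]
    have hg0 : g ≠ 0 := by rintro rfl; simp at hgi
    have hsub : Set.range (Function.update x i (-(x i))) ⊆
        {v ∈ Metric.closedBall (0 : X) 1 | g v = 1} := by
      rintro _ ⟨j, rfl⟩
      exact ⟨by simpa using hy1 j, hgy j⟩
    refine ⟨{v ∈ Metric.closedBall (0 : X) 1 | g v = 1}, ⟨⟨g, 1, hg0, fun v hv => ?_, ?_, rfl⟩,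
      finrank_vectorSpan_add_one_of_level hn hX hy hsub hg0 fun v hv => hv.2⟩, hsub⟩
    · exact (le_abs_self _).trans ((g.le_of_opNorm_le hg v).trans (by simpa using hv))
    · exact ⟨_, (hsub ⟨i, rfl⟩).1, (hsub ⟨i, rfl⟩).2⟩
  · intro h i
    obtain ⟨F, ⟨⟨g, c, hg0, hgc, -, rfl⟩, -⟩, hsub⟩ := h i
    have hle := norm_le_of_forall_closedBall_le hgc
    have hc : 0 < c := (norm_pos_iff.2 hg0).trans_le hle
    have hi : -(g (x i)) = c := by simpa using (hsub ⟨i, rfl⟩).2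
    refine ⟨c⁻¹ • g, ?_, ?_, fun j hj => ?_⟩
    · rw [norm_smul, Real.norm_of_nonneg (by positivity), inv_mul_le_iff₀ hc, mul_one]
      exact hle
    · have : g (x i) = -c := by linarith
      simp [this, hc.ne']
    · have : g (x j) = c := by simpa [hj] using (hsub ⟨j, rfl⟩).2
      simp [this, hc.ne']

/-! ### The two directions of the characterisation -/

theorem exists_eq_sub_smul_of_mem_projections {f : X →L[ℝ] ℝ} (hf : f ≠ 0)
    {P : X →L[ℝ] LinearMap.ker (f : X →ₗ[ℝ] ℝ)}
    (hP : P ∈ projections (LinearMap.ker (f : X →ₗ[ℝ] ℝ))) :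
    ∃ z : X, f z = 1 ∧ ∀ v, (P v : X) = v - f v • z := by
  obtain ⟨u, hu⟩ : ∃ u, f u = 1 := by
    obtain ⟨u, hu⟩ := DFunLike.ne_iff.1 hf
    exact ⟨(f u)⁻¹ • u, by simpa using inv_mul_cancel₀ hu⟩
  have hfP : f (P u) = 0 := (P u).2
  refine ⟨u - P u, by rw [map_sub, hu, hfP, sub_zero], fun v => ?_⟩
  have hv : v - f v • u ∈ LinearMap.ker (f : X →ₗ[ℝ] ℝ) := by simp [hu]
  have h := congrArg (Subtype.val) (hP ⟨_, hv⟩)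
  simp only [map_sub, map_smul, Submodule.coe_sub, Submodule.coe_smul] at h
  rw [smul_sub]
  rw [sub_eq_iff_eq_add.1 h]
  abel

/-- Sum `-g i (P (x i)) ≤ ‖P‖` over `i`: since `f z = 1`, the coordinates of `z` cancel and the left
side totals `2n - 2`. -/
theorem two_sub_two_div_le_norm [FiniteDimensional ℝ X] {n : ℕ} (hn : 1 ≤ n) (hX : Module.finrank ℝ X = n)
    {f : X →L[ℝ] ℝ} (hf : f ≠ 0) {x : Fin n → X} (hx1 : ∀ i, ‖x i‖ ≤ 1)
    (hfx : ∀ i j, f (x i) = f (x j)) (hx : LinearIndependent ℝ x) (hc : CoordCondition x)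
    {P : X →L[ℝ] LinearMap.ker (f : X →ₗ[ℝ] ℝ)}
    (hP : P ∈ projections (LinearMap.ker (f : X →ₗ[ℝ] ℝ))) : 2 - 2 / (n : ℝ) ≤ ‖P‖ := by
  have hn0 : (0 : ℝ) < n := by exact_mod_cast hn
  choose g hg hgi hgj using (coordCondition_iff_exists_functional hX hx).1 hc
  have hspan : ⊤ ≤ Submodule.span ℝ (Set.range x) :=
    (hx.span_eq_top_of_card_eq_finrank' (by simp [hX])).ge
  obtain ⟨z, hfz, hPz⟩ := exists_eq_sub_smul_of_mem_projections hf hP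
  obtain ⟨w, rfl⟩ := (Submodule.mem_span_range_iff_exists_fun ℝ).1
    (hspan (Submodule.mem_top (x := z)))
  let i₀ : Fin n := ⟨0, hn⟩
  have hW : f (x i₀) * ∑ j, w j = 1 := by
    rw [← hfz, map_sum, Finset.mul_sum]
    refine Finset.sum_congr rfl fun j _ => ?_
    rw [map_smul, smul_eq_mul, hfx j i₀, mul_comm]
  have hgP : ∀ i, -g i (P (x i)) = 1 + f (x i₀) * (∑ j, w j) - 2 * f (x i₀) * w i := fun i => by
    rw [hPz, map_sub, map_smul, hgi, hfx i i₀, apply_sum_smul_of_reflection (hgi i) (hgj i),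
      Finset.sum_erase_eq_sub (Finset.mem_univ i), smul_eq_mul]
    ring
  have hle : ∀ i, -g i (P (x i)) ≤ ‖P‖ := fun i =>
    (neg_le_abs _).trans (((g i).le_of_opNorm_le (hg i) _).trans
      (by simpa using P.unit_le_opNorm _ (hx1 i)))
  have hsum := Finset.sum_le_sum fun i (_ : i ∈ Finset.univ) => hle i
  simp only [hgP, hW, Finset.sum_sub_distrib, Finset.sum_const, Finset.card_univ,
    Fintype.card_fin, nsmul_eq_mul, ← Finset.mul_sum] at hsum
  rw [mul_assoc, hW] at hsum
  have h2 : (n : ℝ) * (2 - 2 / n) = 2 * n - 2 := by field_simp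
  refine le_of_mul_le_mul_left ?_ hn0
  linarith

/-- Assuming only `≥` lets it serve both directions. -/
theorem exists_extremal_system [FiniteDimensional ℝ X] {n : ℕ} (hn : 3 ≤ n)
    (hX : Module.finrank ℝ X = n) {f : X →L[ℝ] ℝ} (hf : f ≠ 0)
    (hl : 2 - 2 / (n : ℝ) ≤ relProjConst (LinearMap.ker (f : X →ₗ[ℝ] ℝ))) :
    relProjConst (LinearMap.ker (f : X →ₗ[ℝ] ℝ)) = 2 - 2 / (n : ℝ) ∧
      ∃ x : Fin n → X,
        (∀ i, x i ∈ (Metric.closedBall (0 : X) 1).extremePoints ℝ) ∧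
        (∀ i j, f (x i) = f (x j)) ∧
        LinearIndependent ℝ x ∧
        CoordCondition x := by
  obtain ⟨P, hP, hPl⟩ := exists_norm_eq_relProjConst (LinearMap.ker (f : X →ₗ[ℝ] ℝ))
  rw [← hPl] at hl ⊢
  obtain ⟨a, ⟨ha, ha1⟩, x, g, hx, hg, hgP, hfx, hker⟩ := exists_dual_certificate hf hP
    fun Q hQ => hPl.trans_le (relProjConst_le_norm hQ)
  obtain ⟨z, hfz, hPz⟩ := exists_eq_sub_smul_of_mem_projections hf hP
  subst hX
  have hG1 : ∀ k j, |g k (x j)| ≤ 1 := fun k j =>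
    ((g k).le_of_opNorm_le (hg k) (x j)).trans (by simpa using hx j)
  have hgz : ∀ k, ‖P‖ = g k (x k) - f (x k) * g k z := fun k => by
    rw [← hgP k, hPz, map_sub, map_smul, smul_eq_mul]
  -- If `f (x k) = 0`, then `‖P‖ = g k (x k) ≤ 1 < 2 - 2/n`, as n ≥ 3.
  have hs : ∀ k, 0 < f (x k) := fun k => (hfx k).lt_of_ne fun h0 => by
    have hn' : (3 : ℝ) ≤ Module.finrank ℝ X := by exact_mod_cast hn
    have h1 := hgz k
    rw [← h0, zero_mul, sub_zero] at h1
    have h2 : 2 / (Module.finrank ℝ X : ℝ) < 1 := by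
      rw [div_lt_one (by linarith)]
      linarith
    linarith [(abs_le.1 (hG1 k k)).2]
  have hG : ∀ j, f (x j) * ‖P‖ = f (x j) * ∑ k, a k * g k (x k) -
      ∑ k, a k * f (x k) * g k (x j) := fun j => by
    have h1 := hker (x j - f (x j) • z) (by simp [hfz])
    have h2 : ‖P‖ = ∑ k, a k * (g k (x k) - f (x k) * g k z) := by
      simp only [← hgz, ← Finset.sum_mul, ha1, one_mul]
    have h3 : f (x j) * ‖P‖ = f (x j) * ∑ k, a k * g k (x k) -
        ∑ k, a k * f (x k) * g k (x j) +
        ∑ k, a k * (f (x k) * g k (x j - f (x j) • z)) := by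
      rw [h2]
      simp only [Finset.mul_sum, ← Finset.sum_sub_distrib, ← Finset.sum_add_distrib]
      refine Finset.sum_congr rfl fun k _ => ?_
      rw [map_sub, map_smul, smul_eq_mul]
      ring
    rw [h3, h1, add_zero]
  obtain ⟨hnorm, hdiag, hoff, hconst⟩ :=
    extremal_pairing_rigidity hn ha ha1 hs (G := fun k j => g k (x j)) hG1 hl hG
  have hg' : ∀ i, ‖(-g) i‖ ≤ 1 := fun i => by simpa using hg i
  have hi : ∀ i, (-g) i (x i) = -1 := fun i => by simpa using hdiag i
  have hj : ∀ i j, j ≠ i → (-g) i (x j) = 1 := fun i j h => by simp [hoff i j h]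
  have hli := linearIndependent_of_reflection hn hi hj
  exact ⟨hnorm, x, mem_extremePoints_closedBall_of_reflection hn rfl hg' hi hj hx, hconst, hli,
    (coordCondition_iff_exists_functional rfl hli).2 fun i => ⟨_, hg' i, hi i, hj i⟩⟩

end

theorem theorem1p3 {X : Type*} [NormedAddCommGroup X] [NormedSpace ℝ X] [FiniteDimensional ℝ X]
    (n : ℕ) (hn : 3 ≤ n) (hX : Module.finrank ℝ X = n) (f : X →L[ℝ] ℝ) (hf : ‖f‖ = 1) :
    (relProjConst (LinearMap.ker (f : X →ₗ[ℝ] ℝ)) = 2 - 2 / (n : ℝ) ↔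
      ∃ x : Fin n → X,
        (∀ i, x i ∈ (Metric.closedBall (0 : X) 1).extremePoints ℝ) ∧
        (∀ i j, f (x i) = f (x j)) ∧
        LinearIndependent ℝ x ∧
        CoordCondition x) ∧
    (∀ x : Fin n → X,
      (∀ i, x i ∈ (Metric.closedBall (0 : X) 1).extremePoints ℝ) →
      LinearIndependent ℝ x →
      (CoordCondition x ↔ FacetCondition x)) := by
  have hf0 : f ≠ 0 := by
    rintro rfl
    simp at hf
  have hle : ∀ x : Fin n → X, (∀ i, x i ∈ (Metric.closedBall (0 : X) 1).extremePoints ℝ) →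
      ∀ i, ‖x i‖ ≤ 1 := fun x hx i => by simpa using (hx i).1
  refine ⟨⟨fun h => (exists_extremal_system hn hX hf0 h.ge).2, ?_⟩, fun x hx hli =>
    coordCondition_iff_facetCondition (by omega) hX (hle x hx) hli⟩
  rintro ⟨x, hx, hfx, hli, hc⟩
  refine (exists_extremal_system hn hX hf0 ?_).1
  obtain ⟨P, hP, hPl⟩ := exists_norm_eq_relProjConst (LinearMap.ker (f : X →ₗ[ℝ] ℝ))
  rw [← hPl]
  exact two_sub_two_div_le_norm (by omega) hX hf0 (hle x hx) hfx hli hc hP
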